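/- A hidden Markov model (HMM) generates a stationary two-sided process $(h_t,x_t)_{t\in\mathbb Z}$ of hidden states and outputs. A predictor $\mathcal A_\ell$ with window length $\ell$ is an arbitrary map that sends the last $\ell$ outputs $x_{t-\ell},\dots,x_{t-1}$ to a predicted distribution $Q_{\mathcal A_\ell}(\cdot\mid x_{t-\ell}^{t-1})$ of $x_t$. For a loss $F$ on pairs of distributions its average loss relative to the optimal predictor, which knows the model and the entire past, is $$\delta_F(\mathcal A_\ell)=\lim_{T\to\infty}\frac1T\sum_{t=0}^{T-1}\mathbb E\Big[F\big(\Pr(x_t\mid x_{-\infty}^{t-1}),\,Q_{\mathcal A_\ell}(\cdot\mid x_{t-\ell}^{t-1})\big)\Big].$$ The losses considered are the $\ell_1$ distance $\sum_a|P(a)-Q(a)|$, the KL divergence $\sum_a P(a)\log\frac{P(a)}{Q(a)}$, and the relative zero-one loss $\max_a P(a)-\sum_a Q(a)P(a)$ (the error probability of a guess drawn from $Q$, minus that of the best guess; a deterministic guess is a point mass $Q$). Proposition. There is an absolute constant $c>0$ such that for every $0<\epsilon<1/2$ and all sufficiently large $n$ (depending on $\epsilon$) there exists an HMM with $n$ hidden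 states and binary outputs with the following properties. Its hidden chain is a permutation of the states started from the uniform distribution, and each state $s$ emits a bit attached to $s$ with probability $\frac12+\eta_s$ and the other bit with probability $\frac12-\eta_s$, for some $0<\eta_s<\frac12$. (1) For every $\ell\le c\log n/\epsilon^2$ and every predictor $\mathcal A_\ell$ with window length $\ell$, the average relative zero-one loss and the average $\ell_1$ loss of $\mathcal A_\ell$ exist and are at least $\epsilon$. (2) For every $\ell\le c\log n/\epsilon$ and every predictor $\mathcal A_\ell$ with window length $\ell$, the average KL loss of $\mathcal A_\ell$ exists in $[0,\infty]$ and is at least $\epsilon$. -/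

import Mathlib

open MeasureTheory ProbabilityTheory Filter Topology
open scoped ENNReal

/-- A hidden Markov model with hidden states `S` and output alphabet `O`: a distribution of the
hidden state, a transition kernel and an emission kernel. -/
structure HMM (S O : Type) where
  /-- The distribution of the hidden state. -/
  init : PMF S
  /-- `trans s` is the distribution of the next hidden state. -/
  trans : S → PMF S
  /-- `emit s` is the distribution of the output in hidden state `s`. -/
  emit : S → PMF O

namespace HMM

/-- `μ` is the law of the stationary two-sided process `(h_t, x_t)`, `t ∈ ℤ`, of hidden states and
outputs that is generated by `M`: the distribution `M.init` is stationary for the hidden chain, and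
for every time `t` and length `m + 1`
`Pr(h_t = s₀, x_t = o₀, …, h_{t+m} = s_m, x_{t+m} = o_m)`
`= init s₀ · trans s₀ s₁ ⋯ trans s_{m-1} s_m · emit s₀ o₀ ⋯ emit s_m o_m`.
(These probabilities determine `μ`.) -/
def IsStationaryLaw {S O : Type} [MeasurableSpace S] [MeasurableSpace O] (M : HMM S O)
    (μ : Measure (ℤ → S × O)) : Prop :=
  M.init.bind M.trans = M.init ∧
  ∀ (t : ℤ) (m : ℕ) (s : Fin (m + 1) → S) (o : Fin (m + 1) → O),
    μ {ω | ∀ i : Fin (m + 1), ω (t + (i : ℕ)) = (s i, o i)} =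
      M.init (s 0) * (∏ i : Fin m, M.trans (s i.castSucc) (s i.succ)) *
        ∏ i : Fin (m + 1), M.emit (s i) (o i)

/-- The hidden chain is a (deterministic) permutation of the states, started from the uniform
distribution, and each state `s` carries a label in `{0, 1}` and emits this label with probability
`1/2 + η s` and the other bit with probability `1/2 - η s`, where `0 < η s < 1/2`. -/
def IsBiasedPermutationChain {S : Type} [Fintype S] (M : HMM S Bool) : Prop :=
  (∀ s, M.init s = (Fintype.card S : ℝ≥0∞)⁻¹) ∧
  (∃ σ : Equiv.Perm S, ∀ s, M.trans s = PMF.pure (σ s)) ∧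
  ∃ (label : S → Bool) (η : S → ℝ), ∀ s, 0 < η s ∧ η s < 1 / 2 ∧
    M.emit s (label s) = ENNReal.ofReal (1 / 2 + η s) ∧
    M.emit s (!label s) = ENNReal.ofReal (1 / 2 - η s)

end HMM

/-- A predictor with window length `ℓ` maps the `ℓ` most recent outputs to a predicted
distribution of the next output. There is no computational restriction. -/
abbrev Predictor (O : Type) [MeasurableSpace O] (ℓ : ℕ) : Type :=
  (Fin ℓ → O) → ProbabilityMeasure O

noncomputable section Losses

variable {O : Type} [Fintype O] [MeasurableSpace O]

/-- The `ℓ₁` distance `∑ a, |p a - q a|`. -/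
def l1Loss (p q : Measure O) : ℝ≥0∞ :=
  ENNReal.ofReal (∑ a, |p.real {a} - q.real {a}|)

/-- The zero-one loss: the probability that an independent guess drawn from `q` differs from an
outcome drawn from `p`. A deterministic guess is the case of a point mass `q`. -/
def zeroOneLoss (p q : Measure O) : ℝ :=
  ∑ a, q.real {a} * (1 - p.real {a})

/-- The relative zero-one loss: the zero-one loss of `q` minus that of the best guess for `p`
(a mode of `p`). It is nonnegative for probability measures. -/
def relZeroOneLoss (p q : Measure O) : ℝ≥0∞ :=
  ENNReal.ofReal (zeroOneLoss p q - ⨅ a, (1 - p.real {a}))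

/-- The Kullback-Leibler divergence `∑ a, p a * log (p a / q a)`, natural logarithm; it is `∞`
unless `p` is absolutely continuous with respect to `q`. -/
def klLoss (p q : Measure O) : ℝ≥0∞ :=
  InformationTheory.klDiv p q

end Losses

noncomputable section Prediction

variable {S O : Type} [MeasurableSpace S] [MeasurableSpace O]

/-- The output `x_t` of a trajectory. -/
def output (t : ℤ) (ω : ℤ → S × O) : O := (ω t).2

/-- The outputs `x_{t-1}, x_{t-2}, …`, the entire past before time `t`. -/
def past (t : ℤ) (ω : ℤ → S × O) : ℕ → O := fun k => output (t - 1 - k) ω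

/-- The `ℓ` most recent outputs `x_{t-ℓ}, …, x_{t-1}` before time `t`. -/
def window (ℓ : ℕ) (t : ℤ) (ω : ℤ → S × O) : Fin ℓ → O :=
  fun i => output (t - ℓ + (i : ℕ)) ω

/-- The prediction at time `t` of the optimal predictor, which knows the model and all past
outputs: the conditional distribution of `x_t` given `x_{t-1}, x_{t-2}, …`. -/
def optimalPrediction [StandardBorelSpace O] [Nonempty O]
    (μ : ProbabilityMeasure (ℤ → S × O)) (t : ℤ) (ω : ℤ → S × O) : Measure O :=
  condDistrib (output t) (past t) (μ : Measure (ℤ → S × O)) (past t ω)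

/-- The expected loss at time `t` of the predictor `A` relative to the optimal predictor. -/
def expectedLoss [StandardBorelSpace O] [Nonempty O]
    (μ : ProbabilityMeasure (ℤ → S × O)) (F : Measure O → Measure O → ℝ≥0∞)
    {ℓ : ℕ} (A : Predictor O ℓ) (t : ℤ) : ℝ≥0∞ :=
  ∫⁻ ω, F (optimalPrediction μ t ω) (A (window ℓ t ω) : Measure O) ∂(μ : Measure (ℤ → S × O))

/-- The average loss of `A`, the limit over `T` of the mean of the expected losses at the times
`0, …, T - 1`, exists and equals `δ`. -/
def HasAverageLoss [StandardBorelSpace O] [Nonempty O]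
    (μ : ProbabilityMeasure (ℤ → S × O)) (F : Measure O → Measure O → ℝ≥0∞)
    {ℓ : ℕ} (A : Predictor O ℓ) (δ : ℝ≥0∞) : Prop :=
  Tendsto (fun T : ℕ => (∑ t ∈ Finset.range T, expectedLoss μ F A (t : ℤ)) / (T : ℝ≥0∞))
    atTop (𝓝 δ)

end Prediction

/-! The hidden states are binary words of length `k`, about half of `log₂ n`, and the chain rotates
the word. A state emits its first bit with some bias `η`, so the outputs read one word periodically
through noise. The entire past holds infinitely many readings of the next bit. By the law of large
numbers the optimal predictor therefore knows the emission law (`ae_optimalPrediction`), and the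
loss is measured against a biased bit. A window of length `ℓ` holds at most `ℓ / k` readings.

Flipping the bit to be predicted pairs up the words. The window laws of a pair share mass at least
`1 - 2 η √(ℓ / k)` (`le_overlap`). On the shared mass a single prediction faces both biased bits, at
an average cost of at least `g`, where `g = η` for the zero-one and ℓ₁ losses and `g = log 2 - H(1/2
+ η) ≥ η²` for the divergence. This gives an average loss of at least `g (1 - 2 η √(ℓ / k))` over
the words (`le_sum_wordLoss`).

For small `ε`, windows of order `log n / ε²` call for a bias of order `ε`, while divergence `ε` at
windows of order `log n / ε` calls for one of order `√ε`. One model serves both: it contains many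
copies of the word set, half with each bias, and losses are nonnegative, so each claim may count its
own half. For `ε` bounded below, windows are shorter than the words and one bias close to `1/2`
suffices. -/

set_option linter.unusedSectionVars false

/-! ### The stationary law of a permutation chain -/

section PermutationChain

variable {S : Type} [Fintype S] [Nonempty S] [MeasurableSpace S] [MeasurableSingletonClass S]

/-- The hidden Markov model whose hidden chain is the permutation `σ` started from the uniform
distribution. -/
noncomputable def permHMM (σ : Equiv.Perm S) (p : S → PMF Bool) : HMM S Bool where
  init := PMF.uniformOfFintype S
  trans s := PMF.pure (σ s)
  emit := p

/-- The law of the outputs along the orbit of the state `s`. -/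
noncomputable def orbitOutputs (σ : Equiv.Perm S) (p : S → PMF Bool) (s : S) :
    Measure (ℤ → Bool) :=
  Measure.infinitePi fun t : ℤ => (p ((σ ^ t) s)).toMeasure

/-- The trajectory along the orbit of `s` with outputs `x`. -/
def trajectory (σ : Equiv.Perm S) (s : S) (x : ℤ → Bool) : ℤ → S × Bool :=
  fun t => ((σ ^ t) s, x t)

/-- The law of the two-sided process generated by `permHMM σ p`. -/
noncomputable def permLaw (σ : Equiv.Perm S) (p : S → PMF Bool) : Measure (ℤ → S × Bool) :=
  Measure.sum fun s => (Fintype.card S : ℝ≥0∞)⁻¹ • (orbitOutputs σ p s).map (trajectory σ s)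

instance (σ : Equiv.Perm S) (p : S → PMF Bool) (s : S) :
    IsProbabilityMeasure (orbitOutputs σ p s) := by
  unfold orbitOutputs; infer_instance

lemma measurable_trajectory (σ : Equiv.Perm S) (s : S) : Measurable (trajectory σ s) :=
  measurable_pi_lambda _ fun t => measurable_const.prodMk (measurable_pi_apply t)

instance (σ : Equiv.Perm S) (p : S → PMF Bool) (s : S) :
    IsProbabilityMeasure ((orbitOutputs σ p s).map (trajectory σ s)) :=
  Measure.isProbabilityMeasure_map (measurable_trajectory σ s).aemeasurable

lemma inv_card_mul_card : (Fintype.card S : ℝ≥0∞)⁻¹ * Fintype.card S = 1 :=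
  ENNReal.inv_mul_cancel (by simp) (by simp)

instance (σ : Equiv.Perm S) (p : S → PMF Bool) : IsProbabilityMeasure (permLaw σ p) := by
  constructor
  rw [permLaw, Measure.sum_apply _ MeasurableSet.univ]
  simp only [Measure.smul_apply, measure_univ, smul_eq_mul, mul_one, tsum_fintype,
    Finset.sum_const, Finset.card_univ, nsmul_eq_mul]
  rw [mul_comm, inv_card_mul_card]

lemma lintegral_permLaw (σ : Equiv.Perm S) (p : S → PMF Bool) {f : (ℤ → S × Bool) → ℝ≥0∞}
    (hf : Measurable f) :
    ∫⁻ ω, f ω ∂(permLaw σ p) =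
      (Fintype.card S : ℝ≥0∞)⁻¹ * ∑ s, ∫⁻ x, f (trajectory σ s x) ∂(orbitOutputs σ p s) := by
  rw [permLaw, lintegral_sum_measure, tsum_fintype, Finset.mul_sum]
  refine Finset.sum_congr rfl fun s _ => ?_
  rw [lintegral_smul_measure, lintegral_map hf (measurable_trajectory σ s), smul_eq_mul]

lemma orbitOutputs_map_window (σ : Equiv.Perm S) (p : S → PMF Bool) (s : S) (t : ℤ) {m : ℕ}
    (o : Fin m → Bool) :
    (orbitOutputs σ p s).map (fun x (i : Fin m) => x (t + (i : ℕ))) {o} =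
      ∏ i : Fin m, p ((σ ^ (t + (i : ℕ))) s) (o i) := by
  have hinj : Function.Injective fun i : Fin m => t + ((i : ℕ) : ℤ) := by
    intro i j h; ext; simpa using h
  rw [orbitOutputs, Measure.map_infinitePi_infinitePi_of_inj hinj,
    Measure.infinitePi_singleton_of_fintype]
  exact Finset.prod_congr rfl fun i _ =>
    PMF.toMeasure_apply_singleton _ _ (measurableSet_singleton _)

lemma permHMM_bind (σ : Equiv.Perm S) (p : S → PMF Bool) :
    (permHMM σ p).init.bind (permHMM σ p).trans = (permHMM σ p).init := by
  ext s
  classical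
  rw [PMF.bind_apply, tsum_fintype]
  simp only [permHMM, PMF.uniformOfFintype_apply, PMF.pure_apply, mul_ite, mul_one, mul_zero]
  rw [Finset.sum_eq_single (σ.symm s)]
  · simp
  · intro b _ hb
    rw [if_neg]
    rintro rfl
    simp at hb
  · simp

lemma orbit_of_steps (σ : Equiv.Perm S) {m : ℕ} (s : Fin (m + 1) → S)
    (h : ∀ i : Fin m, s i.succ = σ (s i.castSucc)) (i : Fin (m + 1)) :
    s i = (σ ^ ((i : ℕ) : ℤ)) (s 0) := by
  induction i using Fin.induction with
  | zero => simp
  | succ i ih =>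
    have e : ((i.succ : ℕ) : ℤ) = 1 + ((i.castSucc : ℕ) : ℤ) := by
      rw [Fin.val_succ, Fin.val_castSucc]; push_cast; ring
    rw [h i, ih, e, zpow_one_add, Equiv.Perm.mul_apply]

lemma isStationaryLaw_permLaw (σ : Equiv.Perm S) (p : S → PMF Bool) :
    (permHMM σ p).IsStationaryLaw (permLaw σ p) := by
  classical
  refine ⟨permHMM_bind σ p, fun t m s o => ?_⟩
  have hmeas : MeasurableSet {ω : ℤ → S × Bool | ∀ i : Fin (m + 1), ω (t + (i : ℕ)) = (s i, o i)} := by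
    rw [Set.ofPred_forall]
    exact MeasurableSet.iInter fun i => measurable_pi_apply _ (measurableSet_singleton _)
  have hterm : ∀ s', ((orbitOutputs σ p s').map (trajectory σ s'))
      {ω : ℤ → S × Bool | ∀ i : Fin (m + 1), ω (t + (i : ℕ)) = (s i, o i)} =
      if ∀ i : Fin (m + 1), (σ ^ (t + (i : ℕ))) s' = s i then ∏ i, p (s i) (o i) else 0 := by
    intro s'
    rw [Measure.map_apply (measurable_trajectory σ s') hmeas]
    split_ifs with h
    · have : trajectory σ s' ⁻¹' {ω | ∀ i : Fin (m + 1), ω (t + (i : ℕ)) = (s i, o i)} =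
          (fun (x : ℤ → Bool) (i : Fin (m + 1)) => x (t + (i : ℕ))) ⁻¹' {o} := by
        ext x
        simp [trajectory, h, funext_iff]
      rw [this, ← Measure.map_apply (by fun_prop) (measurableSet_singleton _),
        orbitOutputs_map_window]
      exact Finset.prod_congr rfl fun i _ => by rw [h i]
    · rw [← measure_empty (μ := orbitOutputs σ p s')]
      congr 1
      ext x
      simp only [trajectory, Set.mem_preimage, Set.mem_ofPred_eq, Prod.mk.injEq,
        Set.mem_empty_iff_false, iff_false]
      exact fun h' => h fun i => (h' i).1
  rw [permLaw, Measure.sum_apply _ hmeas, tsum_fintype]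
  simp only [Measure.smul_apply, smul_eq_mul, hterm]
  rw [← Finset.mul_sum]
  simp only [permHMM, PMF.uniformOfFintype_apply, PMF.pure_apply]
  rw [mul_assoc]
  refine congrArg _ ?_
  by_cases h : ∀ i : Fin m, s i.succ = σ (s i.castSucc)
  · have h0 := orbit_of_steps σ s h
    -- Only the orbit that passes through `s 0` at time `t` contributes.
    rw [Finset.prod_eq_one (s := (Finset.univ : Finset (Fin m))) fun i _ => if_pos (h i), one_mul,
      Finset.sum_eq_single ((σ ^ (-t)) (s 0)), if_pos]
    · intro i
      rw [h0 i, ← Equiv.Perm.mul_apply, ← zpow_add]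
      congr 2
      ring
    · intro b _ hb
      rw [if_neg]
      intro h'
      apply hb
      have := h' 0
      simp only [Fin.val_zero, Nat.cast_zero, add_zero] at this
      rw [← this, ← Equiv.Perm.mul_apply, ← zpow_add]
      simp
    · simp
  · rw [Finset.sum_eq_zero]
    · push Not at h
      obtain ⟨i, hi⟩ := h
      rw [Finset.prod_eq_zero (Finset.mem_univ i) (if_neg hi), zero_mul]
    · intro s' _
      rw [if_neg]
      intro h'
      apply h
      intro i
      rw [← h' i.succ, ← h' i.castSucc, ← Equiv.Perm.mul_apply, ← zpow_one_add]
      congr 2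
      simp
      ring

/-! ### The optimal prediction -/

/-- The limiting frequency of `true` along the outputs at distance `N, 2 N, 3 N, …`. -/
noncomputable def pastFrequency (N : ℕ) (x : ℕ → Bool) : ℝ :=
  -- Index `N * (j + 1) - 1` in the past of `t` is the time `t - N * (j + 1)`. The `limsup` is
  -- measurable and needs no limit to exist.
  limsup (fun m : ℕ => (∑ j ∈ Finset.range m, if x (N * (j + 1) - 1) then (1 : ℝ) else 0) / m) atTop

lemma measurable_pastFrequency (N : ℕ) : Measurable (pastFrequency N) := by
  refine Measurable.limsup fun m => ?_
  refine (Finset.measurable_sum _ fun j _ => ?_).div_const _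
  exact Measurable.comp (g := fun b : Bool => if b then (1 : ℝ) else 0) (.of_discrete)
    (measurable_pi_apply _)

/-- Going back by multiples of the order of `σ` returns to the hidden state at time `t`. The outputs
at those times are i.i.d. with its emission law, so the strong law of large numbers applies. -/
lemma ae_pastFrequency (σ : Equiv.Perm S) (p : S → PMF Bool) (s : S) (t : ℤ) :
    ∀ᵐ x ∂(orbitOutputs σ p s),
      pastFrequency (orderOf σ) (fun k => x (t - 1 - k)) = (p ((σ ^ t) s) true).toReal := by
  set N := orderOf σ with hN
  have hNpos : 0 < N := orderOf_pos σ
  let φ : Bool → ℝ := fun b => if b then 1 else 0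
  have hφ : Measurable φ := .of_discrete
  let c : ℕ → ℤ := fun j => t - N * (j + 1)
  have hc : Function.Injective c := by
    intro i j h
    have h2 : (N : ℤ) * (i + 1) = N * (j + 1) := by simp only [c] at h; linarith
    have := mul_left_cancel₀ (by positivity) h2
    exact_mod_cast add_right_cancel this
  have hσ : ∀ j, (σ ^ c j) = σ ^ t := by
    intro j
    have : ((σ : Equiv.Perm S) ^ ((N : ℤ) * (j + 1))) = 1 := by
      rw [zpow_mul, zpow_natCast, hN, pow_orderOf_eq_one, one_zpow]
    rw [zpow_sub, this, inv_one, mul_one]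
  have hindep : iIndepFun (fun (i : ℤ) (x : ℤ → Bool) => φ (x i)) (orbitOutputs σ p s) :=
    iIndepFun_infinitePi (X := fun _ => φ) fun _ => hφ
  have hmap : ∀ j, (orbitOutputs σ p s).map (fun x => x (c j)) = (p ((σ ^ t) s)).toMeasure := by
    intro j
    have := (measurePreserving_eval_infinitePi
      (fun t : ℤ => (p ((σ ^ t) s)).toMeasure) (c j)).map_eq
    rw [hσ j] at this
    exact this
  have hint : ∀ j, ∫ x, φ (x (c j)) ∂(orbitOutputs σ p s) = (p ((σ ^ t) s) true).toReal := by
    intro j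
    have := integral_map (μ := orbitOutputs σ p s) (φ := fun x : ℤ → Bool => x (c j)) (f := φ)
      (measurable_pi_apply _).aemeasurable hφ.aestronglyMeasurable
    rw [← this, hmap, PMF.integral_eq_sum]
    simp [φ]
  have hident : ∀ i, IdentDistrib (fun x => φ (x (c i))) (fun x => φ (x (c 0)))
      (orbitOutputs σ p s) (orbitOutputs σ p s) := by
    intro i
    have h0 : IdentDistrib (fun x : ℤ → Bool => x (c i)) (fun x => x (c 0))
        (orbitOutputs σ p s) (orbitOutputs σ p s) :=
      ⟨(measurable_pi_apply _).aemeasurable, (measurable_pi_apply _).aemeasurable, by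
        rw [hmap, hmap]⟩
    exact h0.comp hφ
  have hslln := strong_law_ae_real (μ := orbitOutputs σ p s) (fun j x => φ (x (c j)))
    (by
      refine Integrable.of_bound (C := 1) (hφ.comp (measurable_pi_apply _)).aestronglyMeasurable ?_
      filter_upwards with x
      simp only [φ]; split_ifs <;> simp)
    (fun i j hij => hindep.indepFun (hc.ne hij)) hident
  filter_upwards [hslln] with x hx
  rw [hint 0] at hx
  rw [pastFrequency, ← hx.limsup_eq]
  congr 1
  ext m
  congr 1
  refine Finset.sum_congr rfl fun j _ => ?_
  have : t - 1 - ((N * (j + 1) - 1 : ℕ) : ℤ) = c j := by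
    have : 1 ≤ N * (j + 1) := Nat.mul_pos hNpos (Nat.succ_pos _)
    push_cast [Nat.cast_sub this]
    simp only [c]; ring
  simp only [this, φ]

/-- The kernel that predicts with the limiting frequency of `true` in the past. -/
noncomputable def frequencyKernel (N : ℕ) : Kernel (ℕ → Bool) Bool where
  -- Truncation at 1 bounds the mass by 2 for every past, so that the kernel is finite; it changes
  -- nothing when the frequency lies in `[0, 1]`.
  toFun x := ENNReal.ofReal (min (pastFrequency N x) 1) • Measure.dirac true +
    ENNReal.ofReal (min (1 - pastFrequency N x) 1) • Measure.dirac false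
  measurable' := by
    refine Measure.measurable_of_measurable_coe _ fun B _ => ?_
    have := measurable_pastFrequency N
    simp only [Measure.add_apply, Measure.smul_apply, smul_eq_mul]
    fun_prop

instance (N : ℕ) : IsFiniteKernel (frequencyKernel N) := by
  refine ⟨⟨2, ENNReal.ofNat_lt_top, fun x => ?_⟩⟩
  change (ENNReal.ofReal (min (pastFrequency N x) 1) • Measure.dirac true +
    ENNReal.ofReal (min (1 - pastFrequency N x) 1) • Measure.dirac false) Set.univ ≤ 2
  simp only [Measure.add_apply, Measure.smul_apply, smul_eq_mul, measure_univ, mul_one]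
  rw [← one_add_one_eq_two]
  exact add_le_add (ENNReal.ofReal_le_one.2 (min_le_right _ _))
    (ENNReal.ofReal_le_one.2 (min_le_right _ _))

lemma PMF.toReal_true_add_false (p : PMF Bool) : (p true).toReal + (p false).toReal = 1 := by
  have := p.tsum_coe
  rw [tsum_fintype, Fintype.sum_bool] at this
  rw [← ENNReal.toReal_add (p.apply_ne_top _) (p.apply_ne_top _), this, ENNReal.toReal_one]

lemma frequencyKernel_eq_toMeasure (N : ℕ) (p : PMF Bool) (x : ℕ → Bool)
    (h : pastFrequency N x = (p true).toReal) : frequencyKernel N x = p.toMeasure := by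
  have hp := p.toReal_true_add_false
  have h0 := ENNReal.toReal_nonneg (a := p true)
  have h1 := ENNReal.toReal_nonneg (a := p false)
  refine Measure.ext_of_singleton fun b => ?_
  rw [PMF.toMeasure_apply_singleton _ _ (measurableSet_singleton _)]
  change (ENNReal.ofReal (min (pastFrequency N x) 1) • Measure.dirac true +
    ENNReal.ofReal (min (1 - pastFrequency N x) 1) • Measure.dirac false) {b} = _
  have e : 1 - (p true).toReal = (p false).toReal := by linarith
  rw [h, min_eq_left (by linarith), min_eq_left (by linarith), e,
    ENNReal.ofReal_toReal (p.apply_ne_top _), ENNReal.ofReal_toReal (p.apply_ne_top _)]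
  cases b <;> simp

lemma indepFun_past_output (σ : Equiv.Perm S) (p : S → PMF Bool) (s : S) (t : ℤ) :
    IndepFun (fun (x : ℤ → Bool) (k : ℕ) => x (t - 1 - k)) (fun x => x t)
      (orbitOutputs σ p s) := by
  have hind : iIndep (fun i : ℤ => MeasurableSpace.comap (fun x : ℤ → Bool => x i) inferInstance)
      (orbitOutputs σ p s) :=
    (iIndepFun_infinitePi (X := fun _ b => b) fun _ => measurable_id :
      iIndepFun (fun (i : ℤ) (x : ℤ → Bool) => x i) (orbitOutputs σ p s))
  have hle : ∀ i : ℤ, MeasurableSpace.comap (fun x : ℤ → Bool => x i) inferInstance ≤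
      (inferInstance : MeasurableSpace (ℤ → Bool)) :=
    fun i => (measurable_pi_apply i).comap_le
  have h := indep_iSup_of_disjoint hle hind (S := Set.Iio t) (T := {t}) (by simp)
  refine indep_of_indep_of_le_left (indep_of_indep_of_le_right h ?_) ?_
  · exact le_iSup₂_of_le t rfl le_rfl
  · rw [MeasurableSpace.pi, MeasurableSpace.comap_iSup]
    refine iSup_le fun k => ?_
    rw [MeasurableSpace.comap_comp]
    exact le_iSup₂_of_le (t - 1 - (k : ℤ)) (by simp only [Set.mem_Iio]; omega) le_rfl

lemma measurable_output (t : ℤ) : Measurable (output t : (ℤ → S × Bool) → Bool) :=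
  measurable_snd.comp (measurable_pi_apply t)

lemma measurable_past (t : ℤ) : Measurable (past t : (ℤ → S × Bool) → ℕ → Bool) :=
  measurable_pi_lambda _ fun _ => measurable_output _

lemma measurable_window (ℓ : ℕ) (t : ℤ) :
    Measurable (window ℓ t : (ℤ → S × Bool) → Fin ℓ → Bool) :=
  measurable_pi_lambda _ fun _ => measurable_output _

/-- Along one orbit the next output is independent of the past, and almost every past has the
frequency at which the kernel equals the emission law. -/
lemma orbit_map_past_output (σ : Equiv.Perm S) (p : S → PMF Bool) (s : S) (t : ℤ) :
    ((orbitOutputs σ p s).map (trajectory σ s)).map (fun ω => (past t ω, output t ω)) =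
      ((orbitOutputs σ p s).map (trajectory σ s)).map (past t) ⊗ₘ
        frequencyKernel (orderOf σ) := by
  have hp : Measurable fun (x : ℤ → Bool) (k : ℕ) => x (t - 1 - k) := by fun_prop
  rw [Measure.map_map ((measurable_past t).prodMk (measurable_output t)) (measurable_trajectory σ s),
    Measure.map_map (measurable_past t) (measurable_trajectory σ s)]
  change (orbitOutputs σ p s).map (fun x => (fun k : ℕ => x (t - 1 - k), x t)) =
    (orbitOutputs σ p s).map (fun x k => x (t - 1 - (k : ℕ))) ⊗ₘ _
  rw [(indepFun_iff_map_prod_eq_prod_map_map hp.aemeasurable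
    (measurable_pi_apply t).aemeasurable).1 (indepFun_past_output σ p s t)]
  have hmap : (orbitOutputs σ p s).map (fun x => x t) = (p ((σ ^ t) s)).toMeasure :=
    (measurePreserving_eval_infinitePi (fun t : ℤ => (p ((σ ^ t) s)).toMeasure) t).map_eq
  rw [hmap, ← Measure.compProd_const]
  refine Measure.compProd_congr ?_
  have hfreq := (ae_map_iff hp.aemeasurable (measurableSet_eq_fun
    (measurable_pastFrequency (orderOf σ)) measurable_const)).2 (ae_pastFrequency σ p s t)
  filter_upwards [hfreq] with x hx
  rw [Kernel.const_apply, frequencyKernel_eq_toMeasure _ _ _ hx]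

/-- The kernel does not depend on the initial state, so the disintegration passes from single orbits
to their mixture. -/
lemma permLaw_map_past_output (σ : Equiv.Perm S) (p : S → PMF Bool) (t : ℤ) :
    (permLaw σ p).map (fun ω => (past t ω, output t ω)) =
      (permLaw σ p).map (past t) ⊗ₘ frequencyKernel (orderOf σ) := by
  rw [permLaw, Measure.map_sum ((measurable_past t).prodMk (measurable_output t)).aemeasurable,
    Measure.map_sum (measurable_past t).aemeasurable, Measure.compProd_sum_left]
  congr 1
  ext1 s
  rw [Measure.map_smul, Measure.map_smul, Measure.compProd_smul_left, orbit_map_past_output]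

/-- The optimal predictor knows the emission distribution of the hidden state. -/
lemma ae_optimalPrediction (σ : Equiv.Perm S) (p : S → PMF Bool)
    (μ : ProbabilityMeasure (ℤ → S × Bool)) (hμ : (μ : Measure _) = permLaw σ p) (t : ℤ) :
    ∀ᵐ ω ∂(permLaw σ p), optimalPrediction μ t ω = (p (ω t).1).toMeasure := by
  have h := condDistrib_ae_eq_of_measure_eq_compProd (past t)
    (measurable_output t).aemeasurable (permLaw_map_past_output σ p t)
  have h1 := ae_of_ae_map (measurable_past t).aemeasurable h
  have h2 : ∀ᵐ ω ∂(permLaw σ p),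
      pastFrequency (orderOf σ) (past t ω) = (p (ω t).1 true).toReal := by
    rw [permLaw, Measure.ae_sum_iff]
    intro s
    refine Measure.ae_smul_measure ?_ _
    refine (ae_map_iff (measurable_trajectory σ s).aemeasurable ?_).2 ?_
    · refine measurableSet_eq_fun ((measurable_pastFrequency _).comp (measurable_past t)) ?_
      exact Measurable.comp (g := fun s => (p s true).toReal) (.of_discrete)
        (measurable_fst.comp (measurable_pi_apply t))
    · exact ae_pastFrequency σ p s t
  obtain ⟨ν, hν⟩ := μ
  obtain rfl : ν = permLaw σ p := hμ
  filter_upwards [h1, h2] with ω h1 h2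
  exact h1.trans (frequencyKernel_eq_toMeasure _ _ _ h2)

/-! ### The average loss of a window predictor -/

/-- The expected loss of a window predictor against the emission distribution of a uniform hidden
state. -/
noncomputable def windowLoss (σ : Equiv.Perm S) (p : S → PMF Bool)
    (F : Measure Bool → Measure Bool → ℝ≥0∞) {ℓ : ℕ} (A : Predictor Bool ℓ) : ℝ≥0∞ :=
  (Fintype.card S : ℝ≥0∞)⁻¹ * ∑ s, ∑ w : Fin ℓ → Bool,
    (∏ i : Fin ℓ, p ((σ ^ ((i : ℕ) - ℓ : ℤ)) s) (w i)) * F (p s).toMeasure (A w : Measure Bool)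

/-- Since `σ ^ t` permutes the states, summing over the state at time `t` instead of time `0`
removes the dependence on `t`. -/
lemma expectedLoss_eq_windowLoss (σ : Equiv.Perm S) (p : S → PMF Bool)
    (μ : ProbabilityMeasure (ℤ → S × Bool)) (hμ : (μ : Measure _) = permLaw σ p)
    (F : Measure Bool → Measure Bool → ℝ≥0∞) {ℓ : ℕ} (A : Predictor Bool ℓ) (t : ℤ) :
    expectedLoss μ F A t = windowLoss σ p F A := by
  let G : S × (Fin ℓ → Bool) → ℝ≥0∞ := fun y => F (p y.1).toMeasure (A y.2 : Measure Bool)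
  have hG : Measurable G := .of_discrete
  have h1 : expectedLoss μ F A t = ∫⁻ ω, G ((ω t).1, window ℓ t ω) ∂(permLaw σ p) := by
    rw [expectedLoss, hμ]
    refine lintegral_congr_ae ?_
    filter_upwards [ae_optimalPrediction σ p μ hμ t] with ω hω
    rw [hω]
  have hGm : Measurable fun ω : ℤ → S × Bool => G ((ω t).1, window ℓ t ω) :=
    hG.comp ((measurable_fst.comp (measurable_pi_apply t)).prodMk (measurable_window ℓ t))
  rw [h1, lintegral_permLaw σ p hGm, windowLoss]
  congr 1
  rw [← Equiv.sum_comp (σ ^ t) fun s => ∑ w : Fin ℓ → Bool,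
    (∏ i : Fin ℓ, p ((σ ^ ((i : ℕ) - ℓ : ℤ)) s) (w i)) * F (p s).toMeasure (A w : Measure Bool)]
  refine Finset.sum_congr rfl fun s _ => ?_
  have h2 : ∫⁻ x, G ((trajectory σ s x t).1, window ℓ t (trajectory σ s x)) ∂(orbitOutputs σ p s) =
      ∫⁻ w, G ((σ ^ t) s, w)
        ∂((orbitOutputs σ p s).map (fun x (i : Fin ℓ) => x (t - ℓ + (i : ℕ)))) := by
    rw [lintegral_map (.of_discrete) (by fun_prop)]
    rfl
  rw [h2, lintegral_fintype]
  refine Finset.sum_congr rfl fun w _ => ?_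
  rw [orbitOutputs_map_window, mul_comm]
  congr 1
  refine Finset.prod_congr rfl fun i _ => ?_
  rw [← Equiv.Perm.mul_apply, ← zpow_add]
  congr 3
  ring_nf

lemma hasAverageLoss_windowLoss (σ : Equiv.Perm S) (p : S → PMF Bool)
    (μ : ProbabilityMeasure (ℤ → S × Bool)) (hμ : (μ : Measure _) = permLaw σ p)
    (F : Measure Bool → Measure Bool → ℝ≥0∞) {ℓ : ℕ} (A : Predictor Bool ℓ) :
    HasAverageLoss μ F A (windowLoss σ p F A) := by
  refine tendsto_const_nhds.congr' ?_
  -- The mean is constant in `T`, except at `T = 0`, where it is an empty sum divided by zero.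
  filter_upwards [eventually_ge_atTop 1] with T hT
  simp only [expectedLoss_eq_windowLoss σ p μ hμ, Finset.sum_const, Finset.card_range,
    nsmul_eq_mul]
  rw [mul_comm, ENNReal.mul_div_cancel_right (by simp; omega) (by simp)]

end PermutationChain

/-! ### One prediction against two opposite biased bits -/

section BiasedBit

/-- The bit `b` with probability `1/2 + η` and the other bit with probability `1/2 - η`. -/
noncomputable def biasedBit (η : Set.Ioo (0 : ℝ) (1 / 2)) (b : Bool) : PMF Bool :=
  PMF.ofFintype (fun a => ENNReal.ofReal (if a = b then 1 / 2 + η else 1 / 2 - η)) <| by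
    have h1 := η.2.1
    have h2 := η.2.2
    rw [Fintype.sum_bool, ← ENNReal.ofReal_add (by split_ifs <;> linarith)
      (by split_ifs <;> linarith)]
    cases b <;> norm_num

lemma biasedBit_apply (η : Set.Ioo (0 : ℝ) (1 / 2)) (b a : Bool) :
    biasedBit η b a = ENNReal.ofReal (if a = b then 1 / 2 + η else 1 / 2 - η) := rfl

lemma biasedBit_real (η : Set.Ioo (0 : ℝ) (1 / 2)) (b a : Bool) :
    (biasedBit η b).toMeasure.real {a} = if a = b then 1 / 2 + (η : ℝ) else 1 / 2 - η := by
  have h1 := η.2.1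
  have h2 := η.2.2
  rw [Measure.real, PMF.toMeasure_apply_singleton _ _ (measurableSet_singleton _),
    biasedBit_apply, ENNReal.toReal_ofReal (by split_ifs <;> linarith)]

lemma real_true_add_real_false (Q : Measure Bool) [IsProbabilityMeasure Q] :
    Q.real {true} + Q.real {false} = 1 := by
  have h := sum_measureReal_singleton (μ := Q) (Finset.univ : Finset Bool)
  rwa [Fintype.sum_bool, Finset.coe_univ, probReal_univ] at h

/-- A guess costs `2 η` when it names the less likely bit. That bit differs in the two cases, so its
two probabilities under `Q` add up to 1. -/
lemma two_mul_le_relZeroOneLoss_add (η : Set.Ioo (0 : ℝ) (1 / 2)) (b : Bool) (Q : Measure Bool)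
    [IsProbabilityMeasure Q] :
    ENNReal.ofReal (2 * η) ≤ relZeroOneLoss (biasedBit η b).toMeasure Q +
      relZeroOneLoss (biasedBit η (!b)).toMeasure Q := by
  have key : ∀ c : Bool, 2 * (η : ℝ) * Q.real {!c} ≤ zeroOneLoss (biasedBit η c).toMeasure Q -
      ⨅ a, (1 - (biasedBit η c).toMeasure.real {a}) := by
    intro c
    have hinf : ⨅ a, (1 - (biasedBit η c).toMeasure.real {a}) ≤ 1 / 2 - η := by
      refine (ciInf_le (Set.finite_range _).bddBelow c).trans ?_
      rw [biasedBit_real, if_pos rfl]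
      linarith
    have hQ : Q.real {false} = 1 - Q.real {true} := by linarith [real_true_add_real_false Q]
    rw [zeroOneLoss, Fintype.sum_bool, biasedBit_real, biasedBit_real]
    cases c <;> simp [hQ] <;> linarith
  have hQ : Q.real {false} = 1 - Q.real {true} := by linarith [real_true_add_real_false Q]
  refine (ENNReal.ofReal_le_ofReal (?_ : _ ≤ 2 * (η : ℝ) * Q.real {!b} +
    2 * (η : ℝ) * Q.real {!!b})).trans
    (ENNReal.ofReal_add_le.trans (add_le_add (ENNReal.ofReal_le_ofReal (key b))
      (ENNReal.ofReal_le_ofReal (key !b))))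
  cases b <;> simp [hQ] <;> linarith

/-- The triangle inequality at the single outcome `b` suffices. -/
lemma two_mul_le_l1Loss_add (η : Set.Ioo (0 : ℝ) (1 / 2)) (b : Bool) (Q : Measure Bool)
    [IsProbabilityMeasure Q] :
    ENNReal.ofReal (2 * η) ≤ l1Loss (biasedBit η b).toMeasure Q +
      l1Loss (biasedBit η (!b)).toMeasure Q := by
  have h1 := η.2.1
  refine (ENNReal.ofReal_le_ofReal ?_).trans ENNReal.ofReal_add_le
  simp only [Fintype.sum_bool, biasedBit_real]
  have e := abs_sub_le (1 / 2 + (η : ℝ)) (Q.real {b}) (1 / 2 - η)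
  rw [show 1 / 2 + (η : ℝ) - (1 / 2 - η) = 2 * η by ring, abs_of_pos (by linarith),
    abs_sub_comm (Q.real {b})] at e
  have n1 := abs_nonneg (1 / 2 + (η : ℝ) - Q.real {true})
  have n2 := abs_nonneg (1 / 2 - (η : ℝ) - Q.real {true})
  have n3 := abs_nonneg (1 / 2 + (η : ℝ) - Q.real {false})
  have n4 := abs_nonneg (1 / 2 - (η : ℝ) - Q.real {false})
  cases b <;> simp at e ⊢ <;> linarith

lemma toReal_klDiv_bool (P Q : Measure Bool) [IsProbabilityMeasure P] [IsProbabilityMeasure Q]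
    (hP : ∀ a, 0 < P.real {a}) (h : InformationTheory.klDiv P Q ≠ ∞) :
    (∀ a, 0 < Q.real {a}) ∧ (InformationTheory.klDiv P Q).toReal =
      ∑ a, P.real {a} * (Real.log (P.real {a}) - Real.log (Q.real {a})) := by
  obtain ⟨hac, hint⟩ := InformationTheory.klDiv_ne_top_iff.1 h
  have hQ : ∀ a, 0 < Q.real {a} := by
    intro a
    refine ENNReal.toReal_pos (fun h0 => ?_) (measure_ne_top _ _)
    have := hP a
    rw [Measure.real, hac h0] at this
    simp at this
  refine ⟨hQ, ?_⟩
  rw [InformationTheory.toReal_klDiv_of_measure_eq hac (by rw [measure_univ, measure_univ]),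
    integral_fintype hint]
  refine Finset.sum_congr rfl fun a _ => ?_
  rw [smul_eq_mul]
  congr 1
  have hd : P.rnDeriv Q a * Q {a} = P {a} := by
    rw [← Measure.setLIntegral_rnDeriv hac {a}, lintegral_singleton]
  have hd' : (P.rnDeriv Q a).toReal * Q.real {a} = P.real {a} := by
    rw [Measure.real, Measure.real, ← hd, ENNReal.toReal_mul]
  rw [llr, ← hd', Real.log_mul _ (hQ a).ne']
  · ring
  · intro h0
    have := hP a
    rw [← hd', h0, zero_mul] at this
    exact this.false

lemma log_le_neg_log_two (x y : ℝ) (hx : 0 < x) (hy : 0 < y) (h : x + y = 1) :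
    Real.log x + Real.log y ≤ -(2 * Real.log 2) := by
  rw [← Real.log_mul hx.ne' hy.ne', ← Real.log_rpow two_pos, ← Real.log_inv]
  refine Real.log_le_log (mul_pos hx hy) ?_
  norm_num
  nlinarith [sq_nonneg (x - y)]

/-- At each outcome the two masses add up to 1, so finite divergences sum to `-2 H(1/2 + η) - log
Q(true) - log Q(false)`, which is least for uniform `Q`. -/
lemma capacity_le_klLoss_add (η : Set.Ioo (0 : ℝ) (1 / 2)) (b : Bool) (Q : Measure Bool)
    [IsProbabilityMeasure Q] :
    ENNReal.ofReal (2 * (Real.log 2 - Real.binEntropy (1 / 2 + η))) ≤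
      klLoss (biasedBit η b).toMeasure Q + klLoss (biasedBit η (!b)).toMeasure Q := by
  have h1 := η.2.1
  have h2 := η.2.2
  unfold klLoss
  by_cases hb : InformationTheory.klDiv (biasedBit η b).toMeasure Q = ∞
  · simp [hb]
  by_cases hb' : InformationTheory.klDiv (biasedBit η (!b)).toMeasure Q = ∞
  · simp [hb']
  have hpos : ∀ c a, 0 < (biasedBit η c).toMeasure.real {a} := by
    intro c a
    rw [biasedBit_real]
    split_ifs <;> linarith
  obtain ⟨hQ, e1⟩ := toReal_klDiv_bool _ Q (hpos b) hb
  obtain ⟨-, e2⟩ := toReal_klDiv_bool _ Q (hpos !b) hb'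
  rw [← ENNReal.ofReal_toReal hb, ← ENNReal.ofReal_toReal hb',
    ← ENNReal.ofReal_add ENNReal.toReal_nonneg ENNReal.toReal_nonneg, e1, e2]
  refine ENNReal.ofReal_le_ofReal ?_
  have hlog := log_le_neg_log_two _ _ (hQ true) (hQ false) (real_true_add_real_false Q)
  have hent : Real.binEntropy (1 / 2 + η) = -((1 / 2 + η) * Real.log (1 / 2 + η)) -
      (1 / 2 - η) * Real.log (1 / 2 - η) := by
    rw [Real.binEntropy, Real.log_inv, Real.log_inv, show 1 - (1 / 2 + (η : ℝ)) = 1 / 2 - η by ring]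
    ring
  rw [hent]
  simp only [Fintype.sum_bool, biasedBit_real]
  cases b <;> simp <;> nlinarith

lemma sqrt_add_sqrt_le (x : ℝ) (h0 : 0 ≤ x) (h1 : x ≤ 1) :
    √(1 + x) + √(1 - x) ≤ 2 - x ^ 2 / 4 := by
  have a := Real.sq_sqrt (show 0 ≤ 1 + x by linarith)
  have b := Real.sq_sqrt (show 0 ≤ 1 - x by linarith)
  have hab : √(1 + x) * √(1 - x) ≤ 1 - x ^ 2 / 2 := by
    rw [← Real.sqrt_mul (by linarith)]
    refine Real.sqrt_le_iff.2 ⟨by nlinarith, by nlinarith [sq_nonneg (x ^ 2)]⟩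
  refine abs_le_of_sq_le_sq' ?_ (by nlinarith) |>.2
  nlinarith [sq_nonneg (x ^ 2)]

/-- This is `log s ≥ 1 - 1 / s` at `s = √t`, the pointwise form of the bound of divergence below by
squared Hellinger distance. -/
lemma two_mul_sub_sqrt_le (t : ℝ) (ht : 0 < t) : 2 * (t - √t) ≤ t * Real.log t := by
  have hs := Real.sqrt_pos.2 ht
  have h := Real.one_sub_inv_le_log_of_pos hs
  rw [Real.log_sqrt ht.le] at h
  have h2 : t * (1 - (√t)⁻¹) = t - √t := by
    have := Real.mul_self_sqrt ht.le
    field_simp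
    nlinarith
  nlinarith

/-- Twice the right side is the sum of `t log t` over `t = 1 ± 2 η`, and the Hellinger bound reduces
the claim to `sqrt_add_sqrt_le`. -/
lemma sq_le_capacity (η : Set.Ioo (0 : ℝ) (1 / 2)) :
    (η : ℝ) ^ 2 ≤ Real.log 2 - Real.binEntropy (1 / 2 + η) := by
  obtain ⟨η, h1, h2⟩ := η
  change η ^ 2 ≤ Real.log 2 - Real.binEntropy (1 / 2 + η)
  have a := two_mul_sub_sqrt_le (1 + 2 * η) (by linarith)
  have b := two_mul_sub_sqrt_le (1 - 2 * η) (by linarith)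
  have c := sqrt_add_sqrt_le (2 * η) (by linarith) (by linarith)
  have e1 : Real.log (1 + 2 * η) = Real.log 2 + Real.log (1 / 2 + η) := by
    rw [← Real.log_mul two_ne_zero (by linarith)]; ring_nf
  have e2 : Real.log (1 - 2 * η) = Real.log 2 + Real.log (1 / 2 - η) := by
    rw [← Real.log_mul two_ne_zero (by linarith)]; ring_nf
  rw [Real.binEntropy, Real.log_inv, Real.log_inv, show 1 - (1 / 2 + η) = 1 / 2 - η by ring]
  rw [e1] at a
  rw [e2] at b
  nlinarith

end BiasedBit

/-! ### Overlap of output laws -/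

section Overlap

/-- The squared Bhattacharyya coefficient bounds the overlap of two distributions. -/
lemma sq_sum_sqrt_mul_le {ι : Type*} [Fintype ι] (P P' : ι → ℝ) (hP : ∀ w, 0 ≤ P w)
    (hP' : ∀ w, 0 ≤ P' w) (h1 : ∑ w, P w = 1) (h1' : ∑ w, P' w = 1) :
    (∑ w, √(P w * P' w)) ^ 2 ≤ (∑ w, min (P w) (P' w)) * (2 - ∑ w, min (P w) (P' w)) := by
  have hmin : ∀ w, 0 ≤ min (P w) (P' w) := fun w => le_min (hP w) (hP' w)
  have hmax : ∀ w, 0 ≤ max (P w) (P' w) := fun w => (hP w).trans (le_max_left _ _)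
  have hsum : ∑ w, max (P w) (P' w) = 2 - ∑ w, min (P w) (P' w) := by
    rw [eq_sub_iff_add_eq, ← Finset.sum_add_distrib]
    simp only [max_add_min, Finset.sum_add_distrib, h1, h1']
    norm_num
  -- Cauchy–Schwarz, since `√(P P') = √min √max`.
  have h := Finset.sum_mul_sq_le_sq_mul_sq Finset.univ (fun w => √(min (P w) (P' w)))
    fun w => √(max (P w) (P' w))
  simp only [Real.sq_sqrt (hmin _), Real.sq_sqrt (hmax _), hsum] at h
  refine le_trans (le_of_eq ?_) h
  congr 1
  refine Finset.sum_congr rfl fun w _ => ?_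
  rw [← Real.sqrt_mul (hmin w), min_mul_max]

/-- The probability of the output `a` in a state with label `b` and bias `η`. -/
noncomputable def biasedMass (η : ℝ) (b a : Bool) : ℝ := if a = b then 1 / 2 + η else 1 / 2 - η

lemma biasedMass_nonneg (η : Set.Ioo (0 : ℝ) (1 / 2)) (b a : Bool) : 0 ≤ biasedMass η b a := by
  have h1 := η.2.1
  have h2 := η.2.2
  unfold biasedMass
  split_ifs <;> linarith

lemma sum_prod_biasedMass (η : ℝ) {ℓ : ℕ} (b : Fin ℓ → Bool) :
    ∑ w : Fin ℓ → Bool, ∏ i, biasedMass η (b i) (w i) = 1 := by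
  rw [← Fintype.piFinset_univ, ← Finset.prod_univ_sum]
  refine Finset.prod_eq_one fun i _ => ?_
  rw [Fintype.sum_bool]
  cases b i <;> simp [biasedMass] <;> norm_num

lemma sum_sqrt_biasedMass (η : Set.Ioo (0 : ℝ) (1 / 2)) (b b' : Bool) :
    ∑ a, √(biasedMass η b a * biasedMass η b' a) = if b ≠ b' then √(1 - 4 * (η : ℝ) ^ 2) else 1 := by
  have h1 := η.2.1
  have h2 := η.2.2
  have hadd : √((1 / 2 + (η : ℝ)) * (1 / 2 - η)) + √((1 / 2 - (η : ℝ)) * (1 / 2 + η)) =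
      √(1 - 4 * (η : ℝ) ^ 2) := by
    rw [mul_comm (1 / 2 - (η : ℝ)), ← two_mul,
      show (1 - 4 * (η : ℝ) ^ 2) = 2 ^ 2 * ((1 / 2 + (η : ℝ)) * (1 / 2 - η)) by ring,
      Real.sqrt_mul (sq_nonneg 2), Real.sqrt_sq zero_le_two]
  have e1 : √((1 / 2 + (η : ℝ)) * (1 / 2 + η)) = 1 / 2 + η := Real.sqrt_mul_self (by linarith)
  have e2 : √((1 / 2 - (η : ℝ)) * (1 / 2 - η)) = 1 / 2 - η := Real.sqrt_mul_self (by linarith)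
  rw [Fintype.sum_bool]
  cases b <;> cases b' <;> simp only [biasedMass, if_true, if_false, reduceCtorEq, ne_eq,
    not_true_eq_false, not_false_eq_true, hadd, e1, e2]
  · ring
  · rw [add_comm, hadd]
  · ring

/-- Outputs of two label sequences that differ in at most `m` places are hard to tell apart. -/
lemma le_overlap (η : Set.Ioo (0 : ℝ) (1 / 2)) {ℓ m : ℕ} (b b' : Fin ℓ → Bool)
    (hm : (Finset.univ.filter fun i => b i ≠ b' i).card ≤ m) :
    1 - 2 * η * √m ≤
      ∑ w : Fin ℓ → Bool, min (∏ i, biasedMass η (b i) (w i)) (∏ i, biasedMass η (b' i) (w i)) := by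
  have h1 := η.2.1
  have h2 := η.2.2
  have hnn : ∀ (b w : Fin ℓ → Bool), 0 ≤ ∏ i, biasedMass η (b i) (w i) := fun b w =>
    Finset.prod_nonneg fun i _ => biasedMass_nonneg η _ _
  have h := sq_sum_sqrt_mul_le (fun w : Fin ℓ → Bool => ∏ i, biasedMass η (b i) (w i))
    (fun w : Fin ℓ → Bool => ∏ i, biasedMass η (b' i) (w i)) (hnn b) (hnn b')
    (sum_prod_biasedMass _ b)
    (sum_prod_biasedMass _ b')
  have hB : ∑ w : Fin ℓ → Bool, √((∏ i, biasedMass η (b i) (w i)) *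
      ∏ i, biasedMass η (b' i) (w i)) =
      √(1 - 4 * (η : ℝ) ^ 2) ^ (Finset.univ.filter fun i => b i ≠ b' i).card := by
    have : ∀ w : Fin ℓ → Bool, √((∏ i, biasedMass η (b i) (w i)) *
        ∏ i, biasedMass η (b' i) (w i)) =
        ∏ i, √(biasedMass η (b i) (w i) * biasedMass η (b' i) (w i)) := by
      intro w
      rw [← Finset.prod_mul_distrib, Real.sqrt_prod]
      exact fun i _ => mul_nonneg (biasedMass_nonneg η _ _) (biasedMass_nonneg η _ _)
    simp only [this]
    rw [← Fintype.piFinset_univ, ← Finset.prod_univ_sum (fun _ => Finset.univ)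
      fun i a => √(biasedMass η (b i) a * biasedMass η (b' i) a)]
    simp only [sum_sqrt_biasedMass]
    rw [Finset.prod_ite, Finset.prod_const, Finset.prod_const_one, mul_one]
  -- For the overlap `x` this reads `(1 - 4 η²) ^ d ≤ x (2 - x) = 1 - (1 - x)²`; Bernoulli's
  -- inequality then gives `(1 - x)² ≤ 4 η² m`.
  rw [hB, pow_right_comm, Real.sq_sqrt (by nlinarith)] at h
  set d := (Finset.univ.filter fun i => b i ≠ b' i).card
  set x := ∑ w : Fin ℓ → Bool, min (∏ i, biasedMass η (b i) (w i)) (∏ i, biasedMass η (b' i) (w i))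
  have hbern := one_add_mul_le_pow (show -2 ≤ -(4 * (η : ℝ) ^ 2) by nlinarith) d
  rw [← sub_eq_add_neg] at hbern
  have hd : (d : ℝ) * (4 * (η : ℝ) ^ 2) ≤ m * (4 * (η : ℝ) ^ 2) :=
    mul_le_mul_of_nonneg_right (by exact_mod_cast hm) (by positivity)
  have hsq : (1 - x) ^ 2 ≤ (2 * η * √m) ^ 2 := by
    rw [mul_pow, Real.sq_sqrt (Nat.cast_nonneg m)]
    nlinarith
  linarith [(abs_le_of_sq_le_sq' hsq (by positivity)).2]

end Overlap

/-! ### The chain of rotated words -/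

section RotatedWords

/-- The hidden states: `q` copies of the binary words of length `k`, and `r` further states. -/
abbrev WordStates (q k r : ℕ) : Type := (Fin q × (ZMod k → Bool)) ⊕ Fin r

/-- The permutation that rotates the word. -/
def wordRotation (q k r : ℕ) : Equiv.Perm (WordStates q k r) where
  toFun := Sum.map (fun y => (y.1, fun j => y.2 (j + 1))) id
  invFun := Sum.map (fun y => (y.1, fun j => y.2 (j - 1))) id
  left_inv := by rintro (⟨a, u⟩ | s) <;> simp
  right_inv := by rintro (⟨a, u⟩ | s) <;> simp

lemma wordRotation_pow_inl (q k r m : ℕ) (a : Fin q) (u : ZMod k → Bool) :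
    (wordRotation q k r ^ m) (Sum.inl (a, u)) = Sum.inl (a, fun j => u (j + m)) := by
  induction m with
  | zero => simp
  | succ m ih =>
    rw [pow_succ', Equiv.Perm.mul_apply, ih]
    simp only [wordRotation, Equiv.coe_fn_mk, Sum.map_inl, Sum.inl.injEq, Prod.mk.injEq, true_and]
    ext j
    push_cast
    ring_nf

lemma wordRotation_zpow_inl (q k r : ℕ) (z : ℤ) (a : Fin q) (u : ZMod k → Bool) :
    (wordRotation q k r ^ z) (Sum.inl (a, u)) = Sum.inl (a, fun j => u (j + z)) := by
  obtain ⟨m, rfl | rfl⟩ := z.eq_nat_or_neg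
  · rw [zpow_natCast, wordRotation_pow_inl]
    simp
  · rw [zpow_neg, zpow_natCast, Equiv.Perm.inv_eq_iff_eq, wordRotation_pow_inl]
    simp

/-- The emissions: the first bit of the word, with a bias that depends on the copy. -/
noncomputable def wordEmission {q : ℕ} (k r : ℕ) (η : Fin q → Set.Ioo (0 : ℝ) (1 / 2)) :
    WordStates q k r → PMF Bool :=
  Sum.elim (fun y => biasedBit (η y.1) (y.2 0)) fun _ => biasedBit ⟨1 / 4, by norm_num⟩ true

/-- Entry `i` of the window lies `ℓ - i` steps back and reads the first bit of the current word
exactly when `k` divides `ℓ - i`, a number from 1 to `ℓ`. -/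
lemma card_window_dvd_le (k ℓ : ℕ) :
    (Finset.univ.filter fun i : Fin ℓ => (((i : ℕ) - ℓ : ℤ) : ZMod k) = 0).card ≤ ℓ / k := by
  rw [← Nat.Ioc_filter_dvd_card_eq_div]
  refine Finset.card_le_card_of_injOn (fun i : Fin ℓ => ℓ - (i : ℕ)) ?_ ?_
  · intro i hi
    have hi := (Finset.mem_filter.1 hi).2
    have hlt := i.2
    rw [ZMod.intCast_zmod_eq_zero_iff_dvd] at hi
    simp only [Finset.coe_filter, Finset.mem_Ioc, Set.mem_ofPred_eq]
    refine ⟨by omega, ?_⟩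
    rw [← Int.natCast_dvd_natCast, Nat.cast_sub hlt.le, ← dvd_neg]
    simpa using hi
  · intro i _ j _ h
    have hi := i.2
    have hj := j.2
    ext
    simp only at h
    omega

/-- The expected loss in the state of the word `u` in a copy with bias `η`. -/
noncomputable def wordLoss {k ℓ : ℕ} (η : Set.Ioo (0 : ℝ) (1 / 2))
    (F : Measure Bool → Measure Bool → ℝ≥0∞) (A : Predictor Bool ℓ) (u : ZMod k → Bool) : ℝ≥0∞ :=
  ∑ w : Fin ℓ → Bool, (∏ i : Fin ℓ, biasedBit η (u ((i : ℕ) - ℓ : ℤ)) (w i)) *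
    F (biasedBit η (u 0)).toMeasure (A w : Measure Bool)

/-- Flipping the first bit of a word. -/
def flipFirst {k : ℕ} (u : ZMod k → Bool) : ZMod k → Bool := Function.update u 0 (!u 0)

lemma flipFirst_involutive (k : ℕ) : Function.Involutive (flipFirst (k := k)) := by
  intro u
  simp [flipFirst]

/-- Each window `w` has probability at least `min (P w) (P' w)` under both words, and there the same
prediction `A w` is charged against both biased bits. -/
lemma le_wordLoss_add {k ℓ : ℕ} (η : Set.Ioo (0 : ℝ) (1 / 2))
    (F : Measure Bool → Measure Bool → ℝ≥0∞) (A : Predictor Bool ℓ) {g : ℝ} (hg : 0 ≤ g)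
    (hF : ∀ b (Q : Measure Bool) [IsProbabilityMeasure Q], ENNReal.ofReal (2 * g) ≤
      F (biasedBit η b).toMeasure Q + F (biasedBit η (!b)).toMeasure Q) (u : ZMod k → Bool) :
    ENNReal.ofReal (2 * (g * (1 - 2 * η * √(ℓ / k : ℕ)))) ≤
      wordLoss η F A u + wordLoss η F A (flipFirst u) := by
  let b : Fin ℓ → Bool := fun i => u ((i : ℕ) - ℓ : ℤ)
  let b' : Fin ℓ → Bool := fun i => flipFirst u ((i : ℕ) - ℓ : ℤ)
  have hcard : (Finset.univ.filter fun i => b i ≠ b' i).card ≤ ℓ / k := by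
    refine (Finset.card_le_card fun i hi => ?_).trans (card_window_dvd_le k ℓ)
    rw [Finset.mem_filter] at hi ⊢
    refine ⟨Finset.mem_univ _, ?_⟩
    by_contra h
    exact hi.2 (Function.update_of_ne h _ _).symm
  have hov := le_overlap η b b' hcard
  set P : (Fin ℓ → Bool) → ℝ := fun w => ∏ i, biasedMass η (b i) (w i)
  set P' : (Fin ℓ → Bool) → ℝ := fun w => ∏ i, biasedMass η (b' i) (w i)
  have hP : ∀ (b w : Fin ℓ → Bool), ∏ i, biasedBit η (b i) (w i) =
      ENNReal.ofReal (∏ i, biasedMass η (b i) (w i)) := by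
    intro b w
    rw [ENNReal.ofReal_prod_of_nonneg fun i _ => biasedMass_nonneg η _ _]
    rfl
  have h0 : flipFirst u 0 = !u 0 := by simp [flipFirst]
  calc ENNReal.ofReal (2 * (g * (1 - 2 * η * √(ℓ / k : ℕ))))
      ≤ ENNReal.ofReal ((∑ w, min (P w) (P' w)) * (2 * g)) :=
        ENNReal.ofReal_le_ofReal (by nlinarith)
    _ = ∑ w, ENNReal.ofReal (min (P w) (P' w)) * ENNReal.ofReal (2 * g) := by
        have hmin : ∀ w, 0 ≤ min (P w) (P' w) := fun w =>
          le_min (Finset.prod_nonneg fun i _ => biasedMass_nonneg η _ _)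
            (Finset.prod_nonneg fun i _ => biasedMass_nonneg η _ _)
        rw [ENNReal.ofReal_mul (Finset.sum_nonneg fun w _ => hmin w),
          ENNReal.ofReal_sum_of_nonneg fun w _ => hmin w, Finset.sum_mul]
    _ ≤ ∑ w, ENNReal.ofReal (min (P w) (P' w)) *
          (F (biasedBit η (u 0)).toMeasure (A w : Measure Bool) +
            F (biasedBit η (!u 0)).toMeasure (A w : Measure Bool)) :=
        Finset.sum_le_sum fun w _ => mul_le_mul_right (hF _ _) _
    _ ≤ _ := by
        rw [wordLoss, wordLoss, ← Finset.sum_add_distrib, h0]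
        refine Finset.sum_le_sum fun w _ => ?_
        rw [mul_add, hP b w, hP b' w]
        gcongr
        · exact min_le_left _ _
        · exact min_le_right _ _

/-- Flipping is an involution, so summing the bound for pairs over all words counts every word
twice. -/
lemma le_sum_wordLoss {k ℓ : ℕ} [NeZero k] (η : Set.Ioo (0 : ℝ) (1 / 2))
    (F : Measure Bool → Measure Bool → ℝ≥0∞) (A : Predictor Bool ℓ) {g : ℝ} (hg : 0 ≤ g)
    (hF : ∀ b (Q : Measure Bool) [IsProbabilityMeasure Q], ENNReal.ofReal (2 * g) ≤
      F (biasedBit η b).toMeasure Q + F (biasedBit η (!b)).toMeasure Q) :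
    2 ^ k * ENNReal.ofReal (g * (1 - 2 * η * √(ℓ / k : ℕ))) ≤
      ∑ u : ZMod k → Bool, wordLoss η F A u := by
  have hflip : ∑ u : ZMod k → Bool, wordLoss η F A (flipFirst u) =
      ∑ u : ZMod k → Bool, wordLoss η F A u :=
    Equiv.sum_comp (flipFirst_involutive k).toPerm _
  have h := Finset.sum_le_sum fun (u : ZMod k → Bool) (_ : u ∈ Finset.univ) =>
    le_wordLoss_add η F A hg hF u
  rw [Finset.sum_add_distrib, hflip, ← two_mul, Finset.sum_const, Finset.card_univ,
    Fintype.card_fun, Fintype.card_bool, ZMod.card, nsmul_eq_mul,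
    ENNReal.ofReal_mul zero_le_two, ENNReal.ofReal_ofNat, mul_left_comm,
    ENNReal.mul_le_mul_iff_right two_ne_zero ENNReal.ofNat_ne_top] at h
  exact_mod_cast h

/-- A lower bound for the loss of every window predictor on rotated words. -/
lemma le_windowLoss_wordRotation {q k r ℓ : ℕ} [NeZero k] (η : Fin q → Set.Ioo (0 : ℝ) (1 / 2))
    (F : Measure Bool → Measure Bool → ℝ≥0∞) (A : Predictor Bool ℓ) {g : Fin q → ℝ}
    (hg : ∀ a, 0 ≤ g a)
    (hF : ∀ a b (Q : Measure Bool) [IsProbabilityMeasure Q], ENNReal.ofReal (2 * g a) ≤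
      F (biasedBit (η a) b).toMeasure Q + F (biasedBit (η a) (!b)).toMeasure Q) {ε : ℝ}
    (hcard : 0 < Fintype.card (WordStates q k r))
    (hε : ε * Fintype.card (WordStates q k r) ≤
      ∑ a, 2 ^ k * (g a * (1 - 2 * η a * √(ℓ / k : ℕ)))) :
    ENNReal.ofReal ε ≤ windowLoss (wordRotation q k r) (wordEmission k r η) F A := by
  have hinl : ∑ a, ∑ u : ZMod k → Bool, wordLoss (η a) F A u ≤
      ∑ s, ∑ w : Fin ℓ → Bool, (∏ i : Fin ℓ, wordEmission k r η
        ((wordRotation q k r ^ ((i : ℕ) - ℓ : ℤ)) s) (w i)) *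
          F (wordEmission k r η s).toMeasure (A w : Measure Bool) := by
    rw [Fintype.sum_sum_type, Fintype.sum_prod_type]
    -- The loss in the `r` further states is discarded.
    refine le_trans (le_of_eq ?_) le_self_add
    refine Finset.sum_congr rfl fun a _ => Finset.sum_congr rfl fun u _ => ?_
    simp only [wordRotation_zpow_inl, wordEmission, Sum.elim_inl, zero_add, wordLoss]
  rw [windowLoss, ← ENNReal.div_eq_inv_mul,
    ENNReal.le_div_iff_mul_le (Or.inl (Nat.cast_ne_zero.2 hcard.ne'))
      (Or.inl (ENNReal.natCast_ne_top _))]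
  refine le_trans ?_ hinl
  rw [← ENNReal.ofReal_natCast, ← ENNReal.ofReal_mul' (Nat.cast_nonneg _)]
  refine (ENNReal.ofReal_le_ofReal hε).trans ?_
  refine (Finset.le_sum_of_subadditive _ ENNReal.ofReal_zero.le
    (fun x y => ENNReal.ofReal_add_le) _ _).trans ?_
  refine Finset.sum_le_sum fun a _ => le_trans (le_of_eq ?_)
    (le_sum_wordLoss (k := k) (η a) F A (hg a) (hF a))
  rw [ENNReal.ofReal_mul (by positivity), ENNReal.ofReal_pow zero_le_two, ENNReal.ofReal_ofNat]

lemma permCongr_symm_zpow_apply {S T : Type} (e : S ≃ T) (σ : Equiv.Perm T) (z : ℤ) (s : S) :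
    (e.symm.permCongr σ ^ z) s = e.symm ((σ ^ z) (e s)) := by
  have : e.symm.permCongr σ ^ z = e.symm.permCongr (σ ^ z) :=
    (map_zpow e.symm.permCongrHom σ z).symm
  rw [this]
  simp [Equiv.permCongr_apply]

lemma windowLoss_permCongr {S T : Type} [Fintype S] [Fintype T] (e : S ≃ T) (σ : Equiv.Perm T)
    (p : T → PMF Bool) (F : Measure Bool → Measure Bool → ℝ≥0∞) {ℓ : ℕ} (A : Predictor Bool ℓ) :
    windowLoss (e.symm.permCongr σ) (fun s => p (e s)) F A = windowLoss σ p F A := by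
  rw [windowLoss, windowLoss, Fintype.card_congr e]
  congr 1
  simp only [permCongr_symm_zpow_apply, Equiv.apply_symm_apply]
  exact Equiv.sum_comp e fun s => ∑ w : Fin ℓ → Bool,
    (∏ i : Fin ℓ, p ((σ ^ ((i : ℕ) - ℓ : ℤ)) s) (w i)) * F (p s).toMeasure (A w : Measure Bool)

end RotatedWords

/-! ### Choice of parameters -/

section Model

lemma card_wordStates (q k r : ℕ) [NeZero k] :
    Fintype.card (WordStates q k r) = q * 2 ^ k + r := by
  simp [ZMod.card]

lemma wordEmission_biased {q k r : ℕ} (η : Fin q → Set.Ioo (0 : ℝ) (1 / 2)) :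
    ∃ (label : WordStates q k r → Bool) (bias : WordStates q k r → ℝ), ∀ s,
      0 < bias s ∧ bias s < 1 / 2 ∧
      wordEmission k r η s (label s) = ENNReal.ofReal (1 / 2 + bias s) ∧
      wordEmission k r η s (!label s) = ENNReal.ofReal (1 / 2 - bias s) := by
  refine ⟨Sum.elim (fun y => y.2 0) fun _ => true,
    Sum.elim (fun y => (η y.1 : ℝ)) fun _ => 1 / 4, ?_⟩
  rintro (y | y)
  · exact ⟨(η y.1).2.1, (η y.1).2.2, by simp [wordEmission, biasedBit_apply],
      by simp [wordEmission, biasedBit_apply]⟩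
  · exact ⟨by norm_num, by norm_num, by simp [wordEmission, biasedBit_apply],
      by simp [wordEmission, biasedBit_apply]⟩

/-- The rotated words as a biased permutation chain on `Fin n`. -/
lemma exists_word_model {q k r n : ℕ} [NeZero k] (hn : q * 2 ^ k + r = n) (hpos : 0 < n)
    (η : Fin q → Set.Ioo (0 : ℝ) (1 / 2)) :
    ∃ (M : HMM (Fin n) Bool) (μ : ProbabilityMeasure (ℤ → Fin n × Bool)),
      M.IsBiasedPermutationChain ∧ M.IsStationaryLaw (μ : Measure (ℤ → Fin n × Bool)) ∧
      ∀ (F : Measure Bool → Measure Bool → ℝ≥0∞) (ℓ : ℕ) (A : Predictor Bool ℓ),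
        HasAverageLoss μ F A (windowLoss (wordRotation q k r) (wordEmission k r η) F A) := by
  have : Nonempty (Fin n) := ⟨⟨0, hpos⟩⟩
  let e : Fin n ≃ WordStates q k r :=
    Fintype.equivOfCardEq (by rw [Fintype.card_fin, card_wordStates, hn])
  let σ := e.symm.permCongr (wordRotation q k r)
  let p : Fin n → PMF Bool := fun s => wordEmission k r η (e s)
  refine ⟨permHMM σ p, ⟨permLaw σ p, inferInstance⟩, ⟨fun s => ?_, ⟨σ, fun s => rfl⟩, ?_⟩,
    isStationaryLaw_permLaw σ p, fun F ℓ A => ?_⟩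
  · rw [permHMM, PMF.uniformOfFintype_apply]
  · obtain ⟨label, bias, h⟩ := wordEmission_biased (k := k) (r := r) η
    exact ⟨fun s => label (e s), fun s => bias (e s), fun s => h (e s)⟩
  · rw [← windowLoss_permCongr e]
    exact hasAverageLoss_windowLoss σ p _ rfl F A

/-- With `k` half the binary logarithm of `n`, the remainder `r < 2 ^ k ≤ √n` is a vanishing share
of the states. -/
lemma exists_word_parameters (θ : ℝ) (hθ : θ < 1) :
    ∀ᶠ n : ℕ in atTop, ∃ k q r : ℕ, k ≠ 0 ∧ 0 < n ∧ q * 2 ^ k + r = n ∧ θ * n ≤ q * 2 ^ k ∧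
      Real.log n / 2 ≤ k ∧ 0 < Real.log n ∧ 2 ≤ q := by
  have hlog : ∀ᶠ n : ℕ in atTop, 5 ≤ Real.log n :=
    (Real.tendsto_log_atTop.comp tendsto_natCast_atTop_atTop).eventually_ge_atTop 5
  have hsq : ∀ᶠ n : ℕ in atTop, 1 / (1 - θ) ^ 2 ≤ (n : ℝ) :=
    tendsto_natCast_atTop_atTop.eventually_ge_atTop _
  filter_upwards [hlog, hsq, eventually_gt_atTop 0] with n hlog hsq hn
  set k := Nat.log 2 n / 2 with hk
  have hlow : 2 ^ k * 2 ^ k ≤ n := by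
    rw [← pow_add]
    exact (Nat.pow_le_pow_right two_pos (by omega)).trans (Nat.pow_log_le_self 2 hn.ne')
  have hup : n < 2 ^ (2 * k + 2) :=
    (Nat.lt_pow_succ_log_self one_lt_two n).trans_le (Nat.pow_le_pow_right two_pos (by omega))
  have hklog : Real.log n / 2 ≤ k := by
    have h1 : Real.log n ≤ (2 * k + 2 : ℕ) * Real.log 2 := by
      rw [← Real.log_pow]
      refine Real.log_le_log (by exact_mod_cast hn) (by exact_mod_cast hup.le)
    -- As `log 2 < 0.7`, the bound `log n ≤ (2 k + 2) log 2` yields `log n ≤ 2 k` once `log n ≥ 5`.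
    have h2 := Real.log_two_lt_d9
    push_cast at h1
    nlinarith
  have hk0 : k ≠ 0 := by
    intro h0
    rw [h0] at hklog
    norm_num at hklog
    linarith
  have hr : n % 2 ^ k < 2 ^ k := Nat.mod_lt _ (by positivity)
  have hq : 2 ^ k ≤ n / 2 ^ k := (Nat.le_div_iff_mul_le (by positivity)).2 hlow
  have hdiv : n / 2 ^ k * 2 ^ k + n % 2 ^ k = n := Nat.div_add_mod' n _
  refine ⟨k, n / 2 ^ k, n % 2 ^ k, hk0, hn, hdiv, ?_, hklog, by linarith,
    le_trans (Nat.le_self_pow hk0 2) hq⟩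
  have hr2 : ((n % 2 ^ k : ℕ) : ℝ) ^ 2 ≤ n := by
    have : (n % 2 ^ k) ^ 2 ≤ n := by
      rw [sq]
      exact (Nat.mul_le_mul hr.le hr.le).trans hlow
    exact_mod_cast this
  have h1θ : 0 < 1 - θ := by linarith
  rw [div_le_iff₀ (by positivity)] at hsq
  have hn' : (0 : ℝ) < n := by exact_mod_cast hn
  have hrn : ((n % 2 ^ k : ℕ) : ℝ) ≤ (1 - θ) * n := by
    refine (abs_le_of_sq_le_sq' (hr2.trans ?_) (by positivity)).2
    nlinarith
  have hdiv' : ((n / 2 ^ k : ℕ) : ℝ) * 2 ^ k + (n % 2 ^ k : ℕ) = n := by exact_mod_cast hdiv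
  linarith

/-- At `η = 1/2` the entropy vanishes and `log 2 > 1/2 > ε`; continuity leaves room to the left. -/
lemma exists_bias_gt (ε : ℝ) (h0 : 0 < ε) (hε : ε < 1 / 2) :
    ∃ η : Set.Ioo (0 : ℝ) (1 / 2), ε < η ∧ ε < Real.log 2 - Real.binEntropy (1 / 2 + η) := by
  have hcont : ContinuousAt (fun η : ℝ => Real.log 2 - Real.binEntropy (1 / 2 + η)) (1 / 2) := by
    have := Real.binEntropy_continuous
    fun_prop
  have hlim : ∀ᶠ η in 𝓝 (1 / 2 : ℝ), ε < Real.log 2 - Real.binEntropy (1 / 2 + η) := by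
    refine hcont.eventually (lt_mem_nhds ?_)
    norm_num
    linarith [Real.log_two_gt_d9]
  have h1 : ∀ᶠ η in 𝓝[<] (1 / 2 : ℝ), ε < Real.log 2 - Real.binEntropy (1 / 2 + η) :=
    hlim.filter_mono nhdsWithin_le_nhds
  obtain ⟨η, ha, hb⟩ := (h1.and (Ioo_mem_nhdsLT hε)).exists
  exact ⟨⟨η, h0.trans hb.1, hb.2⟩, hb.1, ha⟩

/-- If `ε` is bounded below, then windows are shorter than the words and reveal nothing. -/
lemma exists_model_of_large (ε : ℝ) (h0 : 1 / 32 ≤ ε) (hε : ε < 1 / 2) :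
    ∀ᶠ n : ℕ in atTop, ∃ (M : HMM (Fin n) Bool) (μ : ProbabilityMeasure (ℤ → Fin n × Bool)),
        M.IsBiasedPermutationChain ∧ M.IsStationaryLaw (μ : Measure (ℤ → Fin n × Bool)) ∧
        (∀ ℓ : ℕ, (ℓ : ℝ) ≤ 1 / 4096 * Real.log n / ε ^ 2 → ∀ A : Predictor Bool ℓ,
          (∃ δ, HasAverageLoss μ relZeroOneLoss A δ ∧ ENNReal.ofReal ε ≤ δ) ∧
          (∃ δ, HasAverageLoss μ l1Loss A δ ∧ ENNReal.ofReal ε ≤ δ)) ∧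
        (∀ ℓ : ℕ, (ℓ : ℝ) ≤ 1 / 4096 * Real.log n / ε → ∀ A : Predictor Bool ℓ,
          ∃ δ, HasAverageLoss μ klLoss A δ ∧ ENNReal.ofReal ε ≤ δ) := by
  have hpos : 0 < ε := by linarith
  obtain ⟨η, hη, hcap⟩ := exists_bias_gt ε hpos hε
  set cap := Real.log 2 - Real.binEntropy (1 / 2 + η) with hcapdef
  have hm : ε < min (η : ℝ) cap := lt_min hη hcap
  -- A loss of `min η cap` on this share of the states averages to `ε`.
  have hθ : ε / min (η : ℝ) cap < 1 := (div_lt_one (hpos.trans hm)).2 hm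
  filter_upwards [exists_word_parameters _ hθ] with n ⟨k, q, r, hk, hn0, hn, hfrac, hklog, hlog, _⟩
  have : NeZero k := ⟨hk⟩
  obtain ⟨M, μ, hM, hμ, hloss⟩ := exists_word_model hn hn0 fun _ : Fin q => η
  have hzero : ∀ ℓ : ℕ, (ℓ : ℝ) ≤ Real.log n / 4 → ℓ / k = 0 := by
    intro ℓ hℓ
    refine Nat.div_eq_of_lt ?_
    have : (ℓ : ℝ) < k := by linarith
    exact_mod_cast this
  have hsum : ∀ (ℓ : ℕ) (g : ℝ), (ℓ : ℝ) ≤ Real.log n / 4 → min (η : ℝ) cap ≤ g →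
      ε * Fintype.card (WordStates q k r) ≤
        ∑ _a : Fin q, 2 ^ k * (g * (1 - 2 * η * √(ℓ / k : ℕ))) := by
    intro ℓ g hℓ hg
    rw [hzero ℓ hℓ, card_wordStates, hn]
    simp only [Nat.cast_zero, Real.sqrt_zero, mul_zero, sub_zero, mul_one, Finset.sum_const,
      Finset.card_univ, Fintype.card_fin, nsmul_eq_mul]
    calc ε * n = ε / min (η : ℝ) cap * n * min (η : ℝ) cap := by
          field_simp [(hpos.trans hm).ne']
      _ ≤ q * 2 ^ k * g := by
          refine mul_le_mul hfrac hg (hpos.trans hm).le (by positivity)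
      _ = _ := by ring
  have hcard : 0 < Fintype.card (WordStates q k r) := by rw [card_wordStates, hn]; exact hn0
  refine ⟨M, μ, hM, hμ, fun ℓ hℓ A => ?_, fun ℓ hℓ A => ?_⟩
  · have hℓ' : (ℓ : ℝ) ≤ Real.log n / 4 := by
      refine hℓ.trans ?_
      rw [div_le_iff₀ (by positivity)]
      have : 1 / 1024 ≤ ε ^ 2 := by nlinarith
      nlinarith
    exact ⟨⟨_, hloss _ ℓ A, le_windowLoss_wordRotation (g := fun _ => (η : ℝ)) _ _ A
        (fun _ => η.2.1.le) (fun _ b Q _ => two_mul_le_relZeroOneLoss_add η b Q) hcard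
        (hsum ℓ η hℓ' (min_le_left _ _))⟩,
      ⟨_, hloss _ ℓ A, le_windowLoss_wordRotation (g := fun _ => (η : ℝ)) _ _ A
        (fun _ => η.2.1.le) (fun _ b Q _ => two_mul_le_l1Loss_add η b Q) hcard
        (hsum ℓ η hℓ' (min_le_left _ _))⟩⟩
  · have hℓ' : (ℓ : ℝ) ≤ Real.log n / 4 := by
      refine hℓ.trans ?_
      rw [div_le_iff₀ (by positivity)]
      nlinarith
    exact ⟨_, hloss _ ℓ A, le_windowLoss_wordRotation (g := fun _ => cap) _ _ A
        (fun _ => (hpos.trans hcap).le) (fun _ b Q _ => capacity_le_klLoss_add η b Q) hcard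
        (hsum ℓ cap hℓ' (min_le_right _ _))⟩

lemma sum_ite_val_lt {q h : ℕ} (hq : h ≤ q) (x : ℝ) :
    ∑ a : Fin q, (if (a : ℕ) < h then x else 0) = h * x := by
  rw [← Finset.sum_filter, Finset.sum_const, Fin.card_filter_val_lt, min_eq_right hq,
    nsmul_eq_mul]

lemma sum_ite_val_ge {q h : ℕ} (hq : h ≤ q) (x : ℝ) :
    ∑ a : Fin q, (if (a : ℕ) < h then 0 else x) = (q - h) * x := by
  have h1 : ∀ a : Fin q, (if (a : ℕ) < h then 0 else x) = x - if (a : ℕ) < h then x else 0 := by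
    intro a
    split_ifs <;> simp
  simp only [h1, Finset.sum_sub_distrib, sum_ite_val_lt hq]
  simp
  ring

/-- If `ε` is small, then the copies with bias `8 ε` hide the next bit from long windows and
the copies with bias `√(8 ε)` make the divergence large. -/
lemma exists_model_of_small (ε : ℝ) (h0 : 0 < ε) (hε : ε < 1 / 32) :
    ∀ᶠ n : ℕ in atTop, ∃ (M : HMM (Fin n) Bool) (μ : ProbabilityMeasure (ℤ → Fin n × Bool)),
        M.IsBiasedPermutationChain ∧ M.IsStationaryLaw (μ : Measure (ℤ → Fin n × Bool)) ∧
        (∀ ℓ : ℕ, (ℓ : ℝ) ≤ 1 / 4096 * Real.log n / ε ^ 2 → ∀ A : Predictor Bool ℓ,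
          (∃ δ, HasAverageLoss μ relZeroOneLoss A δ ∧ ENNReal.ofReal ε ≤ δ) ∧
          (∃ δ, HasAverageLoss μ l1Loss A δ ∧ ENNReal.ofReal ε ≤ δ)) ∧
        (∀ ℓ : ℕ, (ℓ : ℝ) ≤ 1 / 4096 * Real.log n / ε → ∀ A : Predictor Bool ℓ,
          ∃ δ, HasAverageLoss μ klLoss A δ ∧ ENNReal.ofReal ε ≤ δ) := by
  -- Words fill three quarters of the states, and each bias gets at least a third of the copies
  -- because `q ≥ 2`. Hence each bias holds at least `n / 4` states; with gain `8 ε` and overlap at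
  -- least `1/2` the average loss is at least `ε`.
  filter_upwards [exists_word_parameters (3 / 4) (by norm_num)] with n
    ⟨k, q, r, hk, hn0, hn, hfrac, hklog, hlog, hq2⟩
  have : NeZero k := ⟨hk⟩
  have hk' : (0 : ℝ) < k := by positivity
  have hsqrt : √(8 * ε) < 1 / 2 := by
    rw [Real.sqrt_lt' (by norm_num)]
    linarith
  set h := q / 2 with hh
  have hhq : h ≤ q := by omega
  have hh3 : (q : ℝ) ≤ 3 * h := by
    have : q ≤ 3 * h := by omega
    exact_mod_cast this
  have hh2 : (h : ℝ) ≤ q - h := by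
    have : h + h ≤ q := by omega
    have : (h : ℝ) + h ≤ q := by exact_mod_cast this
    linarith
  let ηa : Set.Ioo (0 : ℝ) (1 / 2) := ⟨8 * ε, by linarith, by linarith⟩
  let ηb : Set.Ioo (0 : ℝ) (1 / 2) := ⟨√(8 * ε), Real.sqrt_pos.2 (by linarith), hsqrt⟩
  let η : Fin q → Set.Ioo (0 : ℝ) (1 / 2) := fun a => if (a : ℕ) < h then ηa else ηb
  obtain ⟨M, μ, hM, hμ, hloss⟩ := exists_word_model hn hn0 η
  have hcard : 0 < Fintype.card (WordStates q k r) := by rw [card_wordStates, hn]; exact hn0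
  have hquarter : (n : ℝ) / 4 ≤ h * 2 ^ k := by
    have : (q : ℝ) * 2 ^ k ≤ 3 * h * 2 ^ k := mul_le_mul_of_nonneg_right hh3 (by positivity)
    linarith
  have hdiv : ∀ (ℓ : ℕ) (x : ℝ), (ℓ : ℝ) ≤ 1 / 4096 * Real.log n / x → 0 < x →
      ((ℓ / k : ℕ) : ℝ) ≤ 1 / (2048 * x) := by
    intro ℓ x hℓ hx
    refine Nat.cast_div_le.trans ?_
    rw [div_le_div_iff₀ hk' (by positivity)]
    rw [le_div_iff₀ hx] at hℓ
    linarith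
  have hgain : ∀ x y : ℝ, 0 ≤ x → y ≤ 1 / 2 →
      ε * Fintype.card (WordStates q k r) ≤ (h + x) * (2 ^ k * (8 * ε * (1 - y))) := by
    intro x y hx hy
    rw [card_wordStates, hn]
    calc ε * n ≤ h * 2 ^ k * (4 * ε) := by nlinarith
      _ ≤ (h + x) * 2 ^ k * (8 * ε * (1 - y)) := by
          refine mul_le_mul ?_ (by nlinarith) (by positivity) (by positivity)
          exact mul_le_mul_of_nonneg_right (by linarith) (by positivity)
      _ = _ := by ring
  -- Each claim credits one kind of copy and counts the other as zero.
  let ga : Fin q → ℝ := fun a => if (a : ℕ) < h then 8 * ε else 0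
  let gb : Fin q → ℝ := fun a => if (a : ℕ) < h then 0 else 8 * ε
  have hga : ∀ a, 0 ≤ ga a := fun a => by simp only [ga]; split_ifs <;> linarith
  have hgb : ∀ a, 0 ≤ gb a := fun a => by simp only [gb]; split_ifs <;> linarith
  refine ⟨M, μ, hM, hμ, fun ℓ hℓ A => ?_, fun ℓ hℓ A => ?_⟩
  · have hd := hdiv ℓ _ hℓ (by positivity)
    -- `2048 ≥ 32²`, and `1 / (32 ε)` is the value at which `2 (8 ε) √(ℓ / k)` equals `1/2`.
    have hs : √(ℓ / k : ℕ) ≤ 1 / (32 * ε) := by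
      refine Real.sqrt_le_iff.2 ⟨by positivity, hd.trans ?_⟩
      rw [div_pow, one_pow]
      refine one_div_le_one_div_of_le (by positivity) ?_
      nlinarith [sq_nonneg ε]
    have hy : 2 * (8 * ε) * √(ℓ / k : ℕ) ≤ 1 / 2 := by
      calc 2 * (8 * ε) * √(ℓ / k : ℕ) ≤ 2 * (8 * ε) * (1 / (32 * ε)) := by gcongr
        _ = 1 / 2 := by field_simp; norm_num
    have hsum : ε * Fintype.card (WordStates q k r) ≤
        ∑ a, 2 ^ k * (ga a * (1 - 2 * η a * √(ℓ / k : ℕ))) := by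
      have : ∀ a : Fin q, 2 ^ k * (ga a * (1 - 2 * η a * √(ℓ / k : ℕ))) =
          if (a : ℕ) < h then 2 ^ k * (8 * ε * (1 - 2 * (8 * ε) * √(ℓ / k : ℕ))) else 0 := by
        intro a
        simp only [ga, η]
        split_ifs <;> simp [ηa]
      simp only [this]
      rw [sum_ite_val_lt hhq]
      simpa using hgain 0 _ le_rfl hy
    have hle : ∀ a, ENNReal.ofReal (2 * ga a) ≤ ENNReal.ofReal (2 * η a) := by
      intro a
      refine ENNReal.ofReal_le_ofReal ?_
      have := (η a).2.1
      simp only [ga, η] at this ⊢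
      split_ifs with hlt
      · exact le_rfl
      · simp [ηb]
    exact ⟨⟨_, hloss _ ℓ A, le_windowLoss_wordRotation _ _ A hga
        (fun a b Q _ => (hle a).trans (two_mul_le_relZeroOneLoss_add (η a) b Q)) hcard hsum⟩,
      ⟨_, hloss _ ℓ A, le_windowLoss_wordRotation _ _ A hga
        (fun a b Q _ => (hle a).trans (two_mul_le_l1Loss_add (η a) b Q)) hcard hsum⟩⟩
  · have hd := hdiv ℓ _ hℓ h0
    have hy : 2 * √(8 * ε) * √(ℓ / k : ℕ) ≤ 1 / 2 := by
      rw [mul_assoc, ← Real.sqrt_mul (by positivity)]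
      have : √(8 * ε * (ℓ / k : ℕ)) ≤ 1 / 4 := by
        refine Real.sqrt_le_iff.2 ⟨by norm_num, ?_⟩
        calc 8 * ε * (ℓ / k : ℕ) ≤ 8 * ε * (1 / (2048 * ε)) := by gcongr
          _ ≤ (1 / 4) ^ 2 := by field_simp; norm_num
      linarith
    have hsum : ε * Fintype.card (WordStates q k r) ≤
        ∑ a, 2 ^ k * (gb a * (1 - 2 * η a * √(ℓ / k : ℕ))) := by
      have : ∀ a : Fin q, 2 ^ k * (gb a * (1 - 2 * η a * √(ℓ / k : ℕ))) =
          if (a : ℕ) < h then 0 else 2 ^ k * (8 * ε * (1 - 2 * √(8 * ε) * √(ℓ / k : ℕ))) := by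
        intro a
        simp only [gb, η]
        split_ifs <;> simp [ηb]
      simp only [this]
      rw [sum_ite_val_ge hhq]
      -- The copies with the larger bias number `q - h`, one more than `h` when `q` is odd.
      have := hgain (q - h - h) _ (by linarith) hy
      rwa [show (h : ℝ) + (q - h - h) = q - h by ring] at this
    have hle : ∀ a, gb a ≤ Real.log 2 - Real.binEntropy (1 / 2 + η a) := by
      intro a
      refine le_trans ?_ (sq_le_capacity (η a))
      simp only [gb, η]
      split_ifs
      · positivity
      · simp only [ηb]
        rw [Real.sq_sqrt (by positivity)]
    exact ⟨_, hloss _ ℓ A, le_windowLoss_wordRotation _ _ A hgb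
        (fun a b Q _ => (ENNReal.ofReal_le_ofReal (by linarith [hle a])).trans
          (capacity_le_klLoss_add (η a) b Q)) hcard hsum⟩

end Model

theorem proposition3 :
    ∃ c : ℝ, 0 < c ∧ ∀ ε : ℝ, 0 < ε → ε < 1 / 2 → ∃ N : ℕ, ∀ n : ℕ, N ≤ n →
      ∃ (M : HMM (Fin n) Bool) (μ : ProbabilityMeasure (ℤ → Fin n × Bool)),
        M.IsBiasedPermutationChain ∧ M.IsStationaryLaw (μ : Measure (ℤ → Fin n × Bool)) ∧
        (∀ ℓ : ℕ, (ℓ : ℝ) ≤ c * Real.log n / ε ^ 2 → ∀ A : Predictor Bool ℓ,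
          (∃ δ, HasAverageLoss μ relZeroOneLoss A δ ∧ ENNReal.ofReal ε ≤ δ) ∧
          (∃ δ, HasAverageLoss μ l1Loss A δ ∧ ENNReal.ofReal ε ≤ δ)) ∧
        (∀ ℓ : ℕ, (ℓ : ℝ) ≤ c * Real.log n / ε → ∀ A : Predictor Bool ℓ,
          ∃ δ, HasAverageLoss μ klLoss A δ ∧ ENNReal.ofReal ε ≤ δ) := by
  refine ⟨1 / 4096, by norm_num, fun ε h0 hε => eventually_atTop.1 ?_⟩
  rcases lt_or_ge ε (1 / 32) with h | h
  · exact exists_model_of_small ε h0 h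
  · exact exists_model_of_large ε h hε
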